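/- Let $\mathbf{k}$ be an algebraically closed field of characteristic different from $2$, and let $\mathcal{C}$ be a symmetric fusion category over $\mathbf{k}$, that is, a $\mathbf{k}$-linear semisimple rigid symmetric tensor category with finitely many simple objects up to isomorphism, finite-dimensional Hom-spaces and $\operatorname{End}(\mathbf{1}) \simeq \mathbf{k}$. Let $K(\mathcal{C})$ be its Grothendieck ring, and let $\psi_2 : K(\mathcal{C}) \to K(\mathcal{C})$ be the second Adams operation, the ring endomorphism given by $\psi_2([X]) = [S^2(X)] - [\Lambda^2(X)]$ for every object $X$ of $\mathcal{C}$, where $S^2(X)$ and $\Lambda^2(X)$ are the symmetric and exterior squares of $X$. Suppose that $\mathcal{C}$ has, up to isomorphism, exactly two self-dual simple objects (simple objects $X$ with $X \simeq X^*$). If $\psi_2$ is an automorphism of $K(\mathcal{C})$, then it has finite and even order. -/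

import Mathlib

open CategoryTheory CategoryTheory.Limits CategoryTheory.MonoidalCategory

universe w v u

namespace SymFusion

attribute [local instance] Abelian.hasFiniteBiproducts

/-! ### Fusion categories -/

/-- A fusion category over a field `k`: a semisimple `k`-linear abelian rigid monoidal category
with `k`-bilinear tensor product, finitely many isomorphism classes of simple objects,
finite-dimensional Hom-spaces, and `End 𝟙 ≃ k`. -/
class IsFusionCategory (k : Type w) [Field k] (C : Type u) [Category.{v} C] [Abelian C]
    [Linear k C] [MonoidalCategory C] [MonoidalPreadditive C] [MonoidalLinear k C]
    [RigidCategory C] : Prop where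
  /-- Every object is a finite direct sum of simple objects. -/
  semisimple : ∀ X : C, ∃ (n : ℕ) (S : Fin n → C),
    (∀ i, Simple (S i)) ∧ Nonempty (X ≅ ⨁ S)
  finite_simples : {s : Skeleton C | ∃ X : C, Simple X ∧ toSkeleton X = s}.Finite
  finiteDimensional_hom : ∀ X Y : C, FiniteDimensional k (X ⟶ Y)
  end_unit : Nonempty (End (𝟙_ C) ≃ₐ[k] k)

/-- The set of isomorphism classes of simple objects `X` with `X ≅ X*`. -/
def selfDualSimples (C : Type u) [Category.{v} C] [Abelian C] [MonoidalCategory C]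
    [RigidCategory C] : Set (Skeleton C) :=
  {s | ∃ X : C, Simple X ∧ Nonempty (X ≅ Xᘁ) ∧ toSkeleton X = s}

/-! ### The Grothendieck ring -/

section GrothendieckRing

variable (C : Type u) [Category.{v} C] [Abelian C] [MonoidalCategory C] [SymmetricCategory C]

/-- The ideal of relations `[X₂] = [X₁] + [X₃]`, for the short exact sequences
`0 ⟶ X₁ ⟶ X₂ ⟶ X₃ ⟶ 0`, in the free abelian group on the isomorphism classes of objects, with
the multiplication induced by `⊗`. (If `⊗` is exact in each variable, as it is in a rigid
category, then the relations already generate this ideal as an additive subgroup.) -/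
noncomputable def grothendieckRelations : Ideal (FreeAbelianGroup (Skeleton C)) :=
  Ideal.span {r | ∃ S : ShortComplex C, S.ShortExact ∧
    r = FreeAbelianGroup.of (toSkeleton S.X₂) -
      (FreeAbelianGroup.of (toSkeleton S.X₁) + FreeAbelianGroup.of (toSkeleton S.X₃))}

/-- The Grothendieck ring `K(C)`. -/
abbrev GrothendieckRing : Type u := FreeAbelianGroup (Skeleton C) ⧸ grothendieckRelations C

variable {C}

/-- The class `[X]` of an object `X` in the Grothendieck ring. -/
noncomputable def cls (X : C) : GrothendieckRing C :=
  Ideal.Quotient.mk (grothendieckRelations C) (FreeAbelianGroup.of (toSkeleton X))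

lemma cls_congr {X Y : C} (e : X ≅ Y) : cls X = cls Y := by
  unfold cls
  rw [congr_toSkeleton_of_iso e]

lemma cls_shortExact {S : ShortComplex C} (hS : S.ShortExact) :
    cls S.X₂ = cls S.X₁ + cls S.X₃ := by
  unfold cls
  rw [← map_add, Ideal.Quotient.eq]
  exact Ideal.subset_span ⟨S, hS, rfl⟩

lemma cls_biprod (X Y : C) : cls (X ⊞ Y) = cls X + cls Y :=
  cls_shortExact (S := ShortComplex.mk (biprod.inl : X ⟶ X ⊞ Y) biprod.snd (by simp))
    (ShortComplex.Splitting.shortExact (ShortComplex.Splitting.ofHasBinaryBiproduct X Y))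

lemma cls_isZero {X : C} (hX : IsZero X) : cls X = 0 := by
  have h0 : IsZero (X ⊞ X) := by
    rw [IsZero.iff_id_eq_zero]
    ext <;> exact hX.eq_of_src _ _
  have e : X ⊞ X ≅ X := h0.iso hX
  have h := cls_biprod X X
  rw [cls_congr e] at h
  simpa using h

lemma cls_unit : cls (𝟙_ C) = 1 := rfl

lemma cls_tensor (X Y : C) : cls (X ⊗ Y) = cls X * cls Y := by
  unfold cls
  rw [← map_mul, FreeAbelianGroup.of_mul_of, Skeleton.toSkeleton_tensorObj]

end GrothendieckRing

/-! ### Symmetric and exterior squares -/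

section Squares

variable {C : Type u} [Category.{v} C] [Abelian C] [MonoidalCategory C] [SymmetricCategory C]

/-- The symmetric square `S²(X)`: the largest quotient of `X ⊗ X` on which the braiding acts
by `1`. -/
noncomputable def symSq (X : C) : C := cokernel (𝟙 (X ⊗ X) - (β_ X X).hom)

/-- The exterior square `Λ²(X)`: the largest quotient of `X ⊗ X` on which the braiding acts
by `-1`. -/
noncomputable def extSq (X : C) : C := cokernel (𝟙 (X ⊗ X) + (β_ X X).hom)

end Squares

/-! ### Eigenspace decompositions of involutions

Helper facts, used to show that `[X] ↦ [S²(X)] - [Λ²(X)]` is a well-defined ring homomorphism. -/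

section Involutions

variable {C : Type u} [Category.{v} C] [Abelian C]

/-- A decomposition `Z = P ⊕ N` for which the endomorphism `s` is `1` on `P` and `-1` on `N`. -/
structure SignSplitting {Z : C} (s : Z ⟶ Z) (P N : C) where
  i : P ⟶ Z
  q : Z ⟶ P
  j : N ⟶ Z
  r : Z ⟶ N
  iq : i ≫ q = 𝟙 P
  jr : j ≫ r = 𝟙 N
  ir : i ≫ r = 0
  jq : j ≫ q = 0
  total : q ≫ i + r ≫ j = 𝟙 Z
  eq_sub : s = q ≫ i - r ≫ j

namespace SignSplitting

variable {Z : C} {s : Z ⟶ Z} {P N : C}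

lemma iq_assoc (h : SignSplitting s P N) {W : C} (f : P ⟶ W) : h.i ≫ h.q ≫ f = f := by
  rw [← Category.assoc, h.iq, Category.id_comp]

lemma jr_assoc (h : SignSplitting s P N) {W : C} (f : N ⟶ W) : h.j ≫ h.r ≫ f = f := by
  rw [← Category.assoc, h.jr, Category.id_comp]

lemma ir_assoc (h : SignSplitting s P N) {W : C} (f : N ⟶ W) : h.i ≫ h.r ≫ f = 0 := by
  rw [← Category.assoc, h.ir, zero_comp]

lemma jq_assoc (h : SignSplitting s P N) {W : C} (f : P ⟶ W) : h.j ≫ h.q ≫ f = 0 := by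
  rw [← Category.assoc, h.jq, zero_comp]

attribute [simp] iq jr ir jq iq_assoc jr_assoc ir_assoc jq_assoc

/-- Passing from `s` to `-s` exchanges the two summands. -/
def neg (h : SignSplitting s P N) : SignSplitting (-s) N P where
  i := h.j
  q := h.r
  j := h.i
  r := h.q
  iq := h.jr
  jr := h.iq
  ir := h.jq
  jq := h.ir
  total := by rw [add_comm, h.total]
  eq_sub := (congrArg Neg.neg h.eq_sub).trans (neg_sub _ _)

/-- Transport along an isomorphism. -/
def conj (h : SignSplitting s P N) {Z' : C} (e : Z ≅ Z') (s' : Z' ⟶ Z')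
    (hs : e.hom ≫ s' = s ≫ e.hom) : SignSplitting s' P N where
  i := h.i ≫ e.hom
  q := e.inv ≫ h.q
  j := h.j ≫ e.hom
  r := e.inv ≫ h.r
  iq := by simp
  jr := by simp
  ir := by simp
  jq := by simp
  total := by
    have := congrArg (fun t => e.inv ≫ t ≫ e.hom) h.total
    simpa using this
  eq_sub := by
    have h1 : s' = e.inv ≫ s ≫ e.hom := by rw [← hs, Iso.inv_hom_id_assoc]
    rw [h1]
    have := congrArg (fun t => e.inv ≫ t ≫ e.hom) h.eq_sub
    simpa using this

lemma eq_zero_of_add_self (k : Type w) [Field k] [Linear k C] [NeZero (2 : k)] {X Y : C}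
    (f : X ⟶ Y) (hf : f + f = 0) : f = 0 := by
  have h2 : (2 : k) • f = 0 := by rw [two_smul, hf]
  exact (smul_eq_zero.mp h2).resolve_left (NeZero.ne 2)

lemma half_add_half (k : Type w) [Field k] [Linear k C] [NeZero (2 : k)] {X Y : C} (f : X ⟶ Y) : (2 : k)⁻¹ • f + (2 : k)⁻¹ • f = f := by
  rw [← two_smul k, smul_smul, mul_inv_cancel₀ (NeZero.ne (2 : k)), one_smul]

lemma half_mul_add (k : Type w) [Field k] [Linear k C] [NeZero (2 : k)] {X Y W : C}
    (a b : X ⟶ Y) (c d : Y ⟶ W) :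
    ((2 : k)⁻¹ • (a + b)) ≫ (c + d) + ((2 : k)⁻¹ • (a - b)) ≫ (c - d) = a ≫ c + b ≫ d := by
  rw [Linear.smul_comp, Linear.smul_comp, ← smul_add, ← half_add_half k (a ≫ c + b ≫ d),
    ← smul_add]
  congr 1
  simp only [Preadditive.add_comp, Preadditive.comp_add, Preadditive.sub_comp,
    Preadditive.comp_sub]
  abel

lemma half_mul_sub (k : Type w) [Field k] [Linear k C] [NeZero (2 : k)] {X Y W : C}
    (a b : X ⟶ Y) (c d : Y ⟶ W) :
    ((2 : k)⁻¹ • (a + b)) ≫ (c + d) - ((2 : k)⁻¹ • (a - b)) ≫ (c - d) = a ≫ d + b ≫ c := by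
  rw [Linear.smul_comp, Linear.smul_comp, ← smul_sub, ← half_add_half k (a ≫ d + b ≫ c),
    ← smul_add]
  congr 1
  simp only [Preadditive.add_comp, Preadditive.comp_add, Preadditive.sub_comp,
    Preadditive.comp_sub]
  abel

lemma one_sub (h : SignSplitting s P N) : 𝟙 Z - s = h.r ≫ h.j + h.r ≫ h.j :=
  (congrArg₂ (fun a b => a - b) h.total.symm h.eq_sub).trans (by abel)

/-- The summand on which `s` is `1` is the cokernel of `1 - s`. -/
noncomputable def posIso (k : Type w) [Field k] [Linear k C] [NeZero (2 : k)]
    (h : SignSplitting s P N) : cokernel (𝟙 Z - s) ≅ P where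
  hom := cokernel.desc _ h.q (by
    rw [h.one_sub]; simp)
  inv := h.i ≫ cokernel.π _
  hom_inv_id := by
    apply coequalizer.hom_ext
    have h2 : h.r ≫ h.j ≫ cokernel.π (𝟙 Z - s) = 0 := by
      apply eq_zero_of_add_self k
      have h3 : (h.r ≫ h.j + h.r ≫ h.j) ≫ cokernel.π (𝟙 Z - s) = 0 := by
        rw [← h.one_sub, cokernel.condition]
      simpa using h3
    have h3 := congrArg (fun t => t ≫ cokernel.π (𝟙 Z - s)) h.total
    simp only [Preadditive.add_comp, Category.assoc, h2, add_zero, Category.id_comp] at h3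
    simpa using h3
  inv_hom_id := by simp

/-- The summand on which `s` is `-1` is the cokernel of `1 + s`. -/
noncomputable def negIso (k : Type w) [Field k] [Linear k C] [NeZero (2 : k)]
    (h : SignSplitting s P N) : cokernel (𝟙 Z + s) ≅ N :=
  cokernelIsoOfEq (sub_neg_eq_add (𝟙 Z) s).symm ≪≫ posIso k h.neg

/-- An involution decomposes its object into the two cokernels, since `2` is invertible. -/
noncomputable def ofInvolution (k : Type w) [Field k] [Linear k C] [NeZero (2 : k)] (s : Z ⟶ Z) (hs : s ≫ s = 𝟙 Z) :
    SignSplitting s (cokernel (𝟙 Z - s)) (cokernel (𝟙 Z + s)) where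
  i := (2 : k)⁻¹ • cokernel.desc _ (𝟙 Z + s) (by simp [hs])
  q := cokernel.π _
  j := (2 : k)⁻¹ • cokernel.desc _ (𝟙 Z - s) (by simp [hs, add_comm])
  r := cokernel.π _
  iq := by
    apply coequalizer.hom_ext
    have h1 : s ≫ cokernel.π (𝟙 Z - s) = cokernel.π (𝟙 Z - s) := by
      have := cokernel.condition (𝟙 Z - s)
      rw [Preadditive.sub_comp, Category.id_comp, sub_eq_zero] at this
      exact this.symm
    have h2 : cokernel.π (𝟙 Z - s) ≫
        ((2 : k)⁻¹ • cokernel.desc (𝟙 Z - s) (𝟙 Z + s) (by simp [hs])) ≫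
          cokernel.π (𝟙 Z - s) = cokernel.π (𝟙 Z - s) := by
      simp only [Linear.smul_comp, Linear.comp_smul, cokernel.π_desc_assoc,
        Preadditive.add_comp, Category.id_comp, h1]
      rw [smul_add, half_add_half k]
    exact h2.trans (Category.comp_id _).symm
  jr := by
    apply coequalizer.hom_ext
    have h1 : s ≫ cokernel.π (𝟙 Z + s) = - cokernel.π (𝟙 Z + s) := by
      have := cokernel.condition (𝟙 Z + s)
      rw [Preadditive.add_comp, Category.id_comp] at this
      exact (neg_eq_of_add_eq_zero_right this).symm
    have h2 : cokernel.π (𝟙 Z + s) ≫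
        ((2 : k)⁻¹ • cokernel.desc (𝟙 Z + s) (𝟙 Z - s) (by simp [hs, add_comm])) ≫
          cokernel.π (𝟙 Z + s) = cokernel.π (𝟙 Z + s) := by
      simp only [Linear.smul_comp, Linear.comp_smul, cokernel.π_desc_assoc,
        Preadditive.sub_comp, Category.id_comp, h1, sub_neg_eq_add]
      rw [smul_add, half_add_half k]
    exact h2.trans (Category.comp_id _).symm
  ir := by
    apply coequalizer.hom_ext
    simp
  jq := by
    apply coequalizer.hom_ext
    simp
  total := by
    simp only [Linear.comp_smul, cokernel.π_desc, ← smul_add]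
    rw [add_add_sub_cancel, smul_add, half_add_half k]
  eq_sub := by
    simp only [Linear.comp_smul, cokernel.π_desc, ← smul_sub]
    rw [add_sub_sub_cancel, smul_add, half_add_half k]

section Tensor

variable [MonoidalCategory C] [MonoidalPreadditive C]

lemma tensor_sub {A B A' B' : C} (f : A ⟶ B) (g g' : A' ⟶ B') :
    f ⊗ₘ (g - g') = f ⊗ₘ g - f ⊗ₘ g' :=
  eq_sub_of_add_eq (by rw [← MonoidalPreadditive.tensor_add, sub_add_cancel])

lemma sub_tensor {A B A' B' : C} (f f' : A ⟶ B) (g : A' ⟶ B') :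
    (f - f') ⊗ₘ g = f ⊗ₘ g - f' ⊗ₘ g :=
  eq_sub_of_add_eq (by rw [← MonoidalPreadditive.add_tensor, sub_add_cancel])

/-- The tensor product of two decompositions. -/
noncomputable def tensor (h : SignSplitting s P N) {Z' : C} {s' : Z' ⟶ Z'} {P' N' : C}
    (h' : SignSplitting s' P' N') :
    SignSplitting (s ⊗ₘ s') ((P ⊗ P') ⊞ (N ⊗ N')) ((P ⊗ N') ⊞ (N ⊗ P')) where
  i := biprod.desc (h.i ⊗ₘ h'.i) (h.j ⊗ₘ h'.j)
  q := biprod.lift (h.q ⊗ₘ h'.q) (h.r ⊗ₘ h'.r)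
  j := biprod.desc (h.i ⊗ₘ h'.j) (h.j ⊗ₘ h'.i)
  r := biprod.lift (h.q ⊗ₘ h'.r) (h.r ⊗ₘ h'.q)
  iq := by ext <;> simp [tensorHom_comp_tensorHom]
  jr := by ext <;> simp [tensorHom_comp_tensorHom]
  ir := by ext <;> simp [tensorHom_comp_tensorHom]
  jq := by ext <;> simp [tensorHom_comp_tensorHom]
  total := by
    have h1 : 𝟙 (Z ⊗ Z') = (h.q ≫ h.i + h.r ≫ h.j) ⊗ₘ (h'.q ≫ h'.i + h'.r ≫ h'.j) := by
      rw [h.total, h'.total, id_tensorHom_id]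
    rw [h1]
    simp only [biprod.lift_desc, tensorHom_comp_tensorHom, MonoidalPreadditive.tensor_add,
      MonoidalPreadditive.add_tensor]
    abel
  eq_sub := by
    have h1 : s ⊗ₘ s' = (h.q ≫ h.i - h.r ≫ h.j) ⊗ₘ (h'.q ≫ h'.i - h'.r ≫ h'.j) :=
      congrArg₂ (fun a b => a ⊗ₘ b) h.eq_sub h'.eq_sub
    rw [h1]
    simp only [biprod.lift_desc, tensorHom_comp_tensorHom, tensor_sub, sub_tensor]
    abel

end Tensor


section Braiding

variable [MonoidalCategory C] [MonoidalPreadditive C] [SymmetricCategory C]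
  (k : Type w) [Field k] [Linear k C] [NeZero (2 : k)]

/-- The decomposition of the braiding of `X ⊗ X` into symmetric and exterior square. -/
noncomputable def ofBraiding (X : C) : SignSplitting (β_ X X).hom (symSq X) (extSq X) :=
  ofInvolution k (β_ X X).hom (SymmetricCategory.symmetry X X)

/-- The braiding on the tensor square of a direct sum. -/
noncomputable def ofSplitting {S : ShortComplex C} (σ : S.Splitting) {P₁ N₁ P₃ N₃ : C}
    (h₁ : SignSplitting (β_ S.X₁ S.X₁).hom P₁ N₁) (h₃ : SignSplitting (β_ S.X₃ S.X₃).hom P₃ N₃) :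
    SignSplitting (β_ S.X₂ S.X₂).hom ((P₁ ⊞ P₃) ⊞ (S.X₁ ⊗ S.X₃)) ((N₁ ⊞ N₃) ⊞ (S.X₁ ⊗ S.X₃)) where
  i := biprod.desc (biprod.desc (h₁.i ≫ (S.f ⊗ₘ S.f)) (h₃.i ≫ (σ.s ⊗ₘ σ.s)))
    ((S.f ⊗ₘ σ.s) + (β_ S.X₁ S.X₃).hom ≫ (σ.s ⊗ₘ S.f))
  q := biprod.lift (biprod.lift ((σ.r ⊗ₘ σ.r) ≫ h₁.q) ((S.g ⊗ₘ S.g) ≫ h₃.q))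
    ((2 : k)⁻¹ • ((σ.r ⊗ₘ S.g) + (S.g ⊗ₘ σ.r) ≫ (β_ S.X₃ S.X₁).hom))
  j := biprod.desc (biprod.desc (h₁.j ≫ (S.f ⊗ₘ S.f)) (h₃.j ≫ (σ.s ⊗ₘ σ.s)))
    ((S.f ⊗ₘ σ.s) - (β_ S.X₁ S.X₃).hom ≫ (σ.s ⊗ₘ S.f))
  r := biprod.lift (biprod.lift ((σ.r ⊗ₘ σ.r) ≫ h₁.r) ((S.g ⊗ₘ S.g) ≫ h₃.r))
    ((2 : k)⁻¹ • ((σ.r ⊗ₘ S.g) - (S.g ⊗ₘ σ.r) ≫ (β_ S.X₃ S.X₁).hom))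
  iq := by
    ext <;> simp [tensorHom_comp_tensorHom_assoc, tensorHom_comp_tensorHom]
    exact half_add_half k _
  jr := by
    ext <;> simp [tensorHom_comp_tensorHom_assoc, tensorHom_comp_tensorHom]
    exact half_add_half k _
  ir := by
    ext <;> simp [tensorHom_comp_tensorHom_assoc, tensorHom_comp_tensorHom]
  jq := by
    ext <;> simp [tensorHom_comp_tensorHom_assoc, tensorHom_comp_tensorHom]
  total := by
    have h1 : 𝟙 (S.X₂ ⊗ S.X₂) = (σ.r ≫ S.f + S.g ≫ σ.s) ⊗ₘ (σ.r ≫ S.f + S.g ≫ σ.s) := by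
      rw [σ.id, id_tensorHom_id]
    have e₁ := congrArg (fun t => (σ.r ⊗ₘ σ.r) ≫ t ≫ (S.f ⊗ₘ S.f)) h₁.total
    have e₃ := congrArg (fun t => (S.g ⊗ₘ S.g) ≫ t ≫ (σ.s ⊗ₘ σ.s)) h₃.total
    simp only [Preadditive.add_comp, Preadditive.comp_add, Category.assoc, Category.id_comp,
      tensorHom_comp_tensorHom] at e₁ e₃
    rw [h1]
    simp only [biprod.lift_desc, Category.assoc, MonoidalPreadditive.tensor_add,
      MonoidalPreadditive.add_tensor]
    rw [add_add_add_comm, half_mul_add k]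
    simp only [Category.assoc, SymmetricCategory.symmetry_assoc, tensorHom_comp_tensorHom]
    rw [← e₁, ← e₃]
    abel
  eq_sub := by
    have h1 : (β_ S.X₂ S.X₂).hom =
        ((σ.r ≫ S.f + S.g ≫ σ.s) ⊗ₘ (σ.r ≫ S.f + S.g ≫ σ.s)) ≫ (β_ S.X₂ S.X₂).hom := by
      rw [σ.id, id_tensorHom_id, Category.id_comp]
    have e₁ : (σ.r ⊗ₘ σ.r) ≫ (β_ S.X₁ S.X₁).hom ≫ (S.f ⊗ₘ S.f) =
        (σ.r ⊗ₘ σ.r) ≫ (h₁.q ≫ h₁.i - h₁.r ≫ h₁.j) ≫ (S.f ⊗ₘ S.f) :=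
      congrArg (fun t => (σ.r ⊗ₘ σ.r) ≫ t ≫ (S.f ⊗ₘ S.f)) h₁.eq_sub
    have e₃ : (S.g ⊗ₘ S.g) ≫ (β_ S.X₃ S.X₃).hom ≫ (σ.s ⊗ₘ σ.s) =
        (S.g ⊗ₘ S.g) ≫ (h₃.q ≫ h₃.i - h₃.r ≫ h₃.j) ≫ (σ.s ⊗ₘ σ.s) :=
      congrArg (fun t => (S.g ⊗ₘ S.g) ≫ t ≫ (σ.s ⊗ₘ σ.s)) h₃.eq_sub
    simp only [Preadditive.sub_comp, Preadditive.comp_sub, Category.assoc] at e₁ e₃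
    rw [h1]
    simp only [biprod.lift_desc, Category.assoc, MonoidalPreadditive.tensor_add,
      MonoidalPreadditive.add_tensor, Preadditive.add_comp]
    rw [add_sub_add_comm, half_mul_sub k]
    simp only [← tensorHom_comp_tensorHom, Category.assoc,
      BraidedCategory.braiding_naturality S.f S.f, BraidedCategory.braiding_naturality S.f σ.s,
      BraidedCategory.braiding_naturality σ.s S.f, BraidedCategory.braiding_naturality σ.s σ.s]
    rw [e₁, e₃]
    abel

end Braiding

end SignSplitting

end Involutions

section AdamsOperation

variable {C : Type u} [Category.{v} C] [Abelian C] [MonoidalCategory C] [SymmetricCategory C]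

lemma sq_sub_eq (k : Type w) [Field k] [Linear k C] [NeZero (2 : k)]
    {X P N : C} (h : SignSplitting (β_ X X).hom P N) :
    cls (symSq X) - cls (extSq X) = cls P - cls N :=
  congrArg₂ (fun a b => a - b) (cls_congr (h.posIso k)) (cls_congr (h.negIso k))

lemma sq_sub_congr (k : Type w) [Field k] [Linear k C] [NeZero (2 : k)] {X Y : C} (e : X ≅ Y) :
    cls (symSq X) - cls (extSq X) = cls (symSq Y) - cls (extSq Y) :=
  sq_sub_eq k ((SignSplitting.ofBraiding k Y).conj (e.symm ⊗ᵢ e.symm) _ (by simp))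

lemma sq_sub_unit (k : Type w) [Field k] [Linear k C] [NeZero (2 : k)] :
    cls (symSq (𝟙_ C)) - cls (extSq (𝟙_ C)) = (1 : GrothendieckRing C) := by
  let _ := HasZeroObject.zero' C
  let h : SignSplitting (β_ (𝟙_ C) (𝟙_ C)).hom (𝟙_ C) (0 : C) :=
    { i := (λ_ (𝟙_ C)).inv
      q := (λ_ (𝟙_ C)).hom
      j := 0
      r := 0
      iq := by simp
      jr := (isZero_zero C).eq_of_src _ _
      ir := by simp
      jq := by simp
      total := by simp
      eq_sub := by rw [braiding_tensorUnit_left, unitors_inv_equal]; simp }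
  rw [sq_sub_eq k h, cls_unit, cls_isZero (isZero_zero C), sub_zero]

variable [MonoidalPreadditive C]

lemma sq_sub_tensor (k : Type w) [Field k] [Linear k C] [NeZero (2 : k)]
    (X Y : C) :
    cls (symSq (X ⊗ Y)) - cls (extSq (X ⊗ Y)) =
      (cls (symSq X) - cls (extSq X)) * (cls (symSq Y) - cls (extSq Y)) := by
  let e : (X ⊗ X) ⊗ (Y ⊗ Y) ≅ (X ⊗ Y) ⊗ (X ⊗ Y) :=
    ⟨tensorμ X X Y Y, tensorδ X X Y Y, tensorμ_tensorδ X X Y Y, tensorδ_tensorμ X X Y Y⟩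
  rw [sq_sub_eq k (((SignSplitting.ofBraiding k X).tensor (SignSplitting.ofBraiding k Y)).conj e _
    (SymmetricCategory.tensorμ_braid_swap X Y))]
  simp only [cls_biprod, cls_tensor]
  ring

lemma sq_sub_splitting (k : Type w) [Field k] [Linear k C] [NeZero (2 : k)]
    {S : ShortComplex C} (σ : S.Splitting) :
    cls (symSq S.X₂) - cls (extSq S.X₂) =
      (cls (symSq S.X₁) - cls (extSq S.X₁)) + (cls (symSq S.X₃) - cls (extSq S.X₃)) := by
  rw [sq_sub_eq k (SignSplitting.ofSplitting k σ (SignSplitting.ofBraiding k S.X₁)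
    (SignSplitting.ofBraiding k S.X₃))]
  simp only [cls_biprod]
  ring

end AdamsOperation

section Semisimple

variable {C : Type u} [Category.{v} C] [Abelian C]

/-- If all objects are direct sums of simple objects, then epimorphisms split. -/
lemma exists_section (hC : ∀ X : C, ∃ (n : ℕ) (S : Fin n → C),
    (∀ i, Simple (S i)) ∧ Nonempty (X ≅ ⨁ S)) {X Y : C} (g : X ⟶ Y) [Epi g] :
    ∃ s : Y ⟶ X, s ≫ g = 𝟙 Y := by
  have key : ∀ (T : C) [Simple T] (t : T ⟶ Y), ∃ l : T ⟶ X, l ≫ g = t := by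
    intro T _ t
    obtain ⟨n, S, hS, ⟨e⟩⟩ := hC (pullback g t)
    have hsnd : pullback.snd g t ≠ 0 := by
      intro h0
      have : Epi (pullback.snd g t) := inferInstance
      apply id_nonzero T
      rw [← cancel_epi (pullback.snd g t), h0, zero_comp, zero_comp]
    obtain ⟨i, hi⟩ : ∃ i, biproduct.ι S i ≫ e.inv ≫ pullback.snd g t ≠ 0 := by
      by_contra! h
      apply hsnd
      rw [← cancel_epi e.inv, comp_zero]
      ext i
      simpa using h i
    have := hS i
    have := isIso_of_hom_simple hi
    refine ⟨inv (biproduct.ι S i ≫ e.inv ≫ pullback.snd g t) ≫ biproduct.ι S i ≫ e.inv ≫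
      pullback.fst g t, ?_⟩
    rw [Category.assoc, IsIso.inv_comp_eq]
    simp only [Category.assoc, pullback.condition]
  obtain ⟨n, T, hT, ⟨e⟩⟩ := hC Y
  choose l hl using fun i => (have := hT i; key (T i) (biproduct.ι T i ≫ e.inv))
  refine ⟨e.hom ≫ biproduct.desc l, ?_⟩
  rw [Category.assoc, ← cancel_epi e.inv]
  ext i
  simp [hl]

lemma nonempty_splitting (hC : ∀ X : C, ∃ (n : ℕ) (S : Fin n → C),
    (∀ i, Simple (S i)) ∧ Nonempty (X ≅ ⨁ S)) {S : ShortComplex C} (hS : S.ShortExact) :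
    Nonempty S.Splitting := by
  have := hS.mono_f
  have := hS.epi_g
  obtain ⟨s, hs⟩ := exists_section hC S.g
  exact ⟨ShortComplex.Splitting.ofExactOfSection S hS.exact s hs hS.mono_f⟩

end Semisimple

/-! ### The second Adams operation -/

section AdamsTwo

variable (k : Type w) [Field k] [NeZero (2 : k)] (C : Type u) [Category.{v} C] [Abelian C]
    [Linear k C] [MonoidalCategory C] [MonoidalPreadditive C] [SymmetricCategory C]

/-- The map `[X] ↦ [S²(X)] - [Λ²(X)]` on isomorphism classes of objects. -/
noncomputable def adamsTwoObj : Skeleton C →* GrothendieckRing C where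
  toFun x := cls (symSq ((fromSkeleton C).obj x)) - cls (extSq ((fromSkeleton C).obj x))
  map_one' := by
    exact (sq_sub_congr k (fromSkeletonToSkeletonIso (𝟙_ C))).trans (sq_sub_unit k)
  map_mul' x y := by
    rw [← sq_sub_tensor k]
    exact sq_sub_congr k (fromSkeletonToSkeletonIso _)

lemma adamsTwoObj_toSkeleton (X : C) :
    adamsTwoObj k C (toSkeleton X) = cls (symSq X) - cls (extSq X) :=
  sq_sub_congr k (fromSkeletonToSkeletonIso X)

/-- The second Adams operation `ψ₂ : K(C) → K(C)` of a symmetric fusion category in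
characteristic different from `2`: the ring endomorphism with `ψ₂[X] = [S²(X)] - [Λ²(X)]` for
every object `X` (see `adamsTwo_cls`). -/
noncomputable def adamsTwo [MonoidalLinear k C] [RigidCategory C] [IsFusionCategory k C] :
    GrothendieckRing C →+* GrothendieckRing C :=
  Ideal.Quotient.lift (grothendieckRelations C) (FreeAbelianGroup.liftMonoid (adamsTwoObj k C)) (by
    intro a ha
    rw [← RingHom.mem_ker]
    revert a
    refine Ideal.span_le.mpr ?_
    rintro _ ⟨S, hS, rfl⟩
    obtain ⟨σ⟩ := nonempty_splitting (IsFusionCategory.semisimple k) hS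
    have h := sq_sub_splitting k σ
    rw [SetLike.mem_coe, RingHom.mem_ker, map_sub, map_add]
    simp only [FreeAbelianGroup.liftMonoid_coe, FreeAbelianGroup.lift_apply_of,
      adamsTwoObj_toSkeleton]
    rw [h, sub_self])

lemma adamsTwo_cls [MonoidalLinear k C] [RigidCategory C] [IsFusionCategory k C] (X : C) :
    adamsTwo k C (cls X) = cls (symSq X) - cls (extSq X) := by
  unfold adamsTwo cls
  rw [Ideal.Quotient.lift_mk, FreeAbelianGroup.liftMonoid_coe, FreeAbelianGroup.lift_apply_of,
    adamsTwoObj_toSkeleton]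
  rfl

end AdamsTwo

end SymFusion

/-! Write `K` for the Grothendieck ring; since `[X]² = [S²X] + [Λ²X]`, `ψ₂` lifts the squaring map
modulo `2`.

Finite order. By semisimplicity and Schur's lemma, the classes of simple objects form a finite
`ℤ`-basis of `K`, with coordinates `dim Hom(X, -)`. If `ψ₂` is bijective and `a² = 0`, then `ψ₂ a`
lies in `2K`, so `a = 2c` with again `c² = 0`; hence `a` is infinitely `2`-divisible and vanishes.
So `K` is reduced (`isReduced_of_frobenius_lift`). A reduced ring that is finite over `ℤ` has only
finitely many endomorphisms (`finite_ringHom_self`), and an injective one then has finite order.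

Even order. Let `N` be the subgroup `dualNorms`, generated by `2K` and all `[Y] + [Y*]`. It is
stable under squaring, so modulo `N` applying `ψ₂` amounts to squaring
(`adamsTwo_sub_sq_mem_dualNorms`). The multiplicity of a self-dual simple object is well defined
modulo `2` on `K/N`, and a duality-invariant class is congruent to its self-dual part. If `𝟙` and
`X` are the self-dual simple objects, then `x = [X]` satisfies `x² ≡ 1 + m x`
(`cls_sq_sub_mem_dualNorms`). For `m` even, `x` is sent to `1` and never returns, so no positive
power of `ψ₂` is the identity. For `m` odd, `x` and `1 + x` are exchanged, as by the Frobenius of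
the field with four elements, so only even powers can be the identity. -/

namespace SymFusion

attribute [local instance] Abelian.hasFiniteBiproducts

/-! ### Dimensions of Hom-spaces in semisimple and rigid categories -/

section HomDim

variable (k : Type w) [Field k] {C : Type u} [Category.{v} C] [Abelian C] [Linear k C]

/-- The dimension of the space of morphisms `X ⟶ Y`. -/
noncomputable def homDim (X Y : C) : ℕ := Module.finrank k (X ⟶ Y)

lemma homDim_congr {X X' Y Y' : C} (e : X ≅ X') (f : Y ≅ Y') :
    homDim k X Y = homDim k X' Y' :=
  (Linear.homCongr k e f).finrank_eq

lemma homDim_congr_left {X X' : C} (e : X ≅ X') (Y : C) : homDim k X Y = homDim k X' Y :=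
  homDim_congr k e (Iso.refl Y)

lemma homDim_congr_right (X : C) {Y Y' : C} (e : Y ≅ Y') : homDim k X Y = homDim k X Y' :=
  homDim_congr k (Iso.refl X) e

section FiniteDimensional

variable [∀ X Y : C, FiniteDimensional k (X ⟶ Y)]

lemma homDim_biproduct_left {n : ℕ} (S : Fin n → C) (Y : C) :
    homDim k (⨁ S) Y = ∑ i, homDim k (S i) Y := by
  let e : (⨁ S ⟶ Y) ≃ₗ[k] ((i : Fin n) → (S i ⟶ Y)) :=
    { toFun := fun f i => biproduct.ι S i ≫ f
      invFun := fun f => biproduct.desc f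
      map_add' := fun f g => by ext i; simp
      map_smul' := fun r f => by ext i; simp
      left_inv := fun f => by ext i; simp
      right_inv := fun f => by ext i; simp }
  unfold homDim
  rw [e.finrank_eq, Module.finrank_pi_fintype]

lemma homDim_biproduct_right {n : ℕ} (X : C) (S : Fin n → C) :
    homDim k X (⨁ S) = ∑ i, homDim k X (S i) := by
  let e : (X ⟶ ⨁ S) ≃ₗ[k] ((i : Fin n) → (X ⟶ S i)) :=
    { toFun := fun f i => f ≫ biproduct.π S i
      invFun := fun f => biproduct.lift f
      map_add' := fun f g => by ext i; simp
      map_smul' := fun r f => by ext i; simp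
      left_inv := fun f => by ext i; simp
      right_inv := fun f => by ext i; simp }
  unfold homDim
  rw [e.finrank_eq, Module.finrank_pi_fintype]

lemma homDim_splitting (X : C) {S : ShortComplex C} (σ : S.Splitting) :
    homDim k X S.X₂ = homDim k X S.X₁ + homDim k X S.X₃ := by
  let e : (X ⟶ S.X₂) ≃ₗ[k] (X ⟶ S.X₁) × (X ⟶ S.X₃) :=
    { toFun := fun f => (f ≫ σ.r, f ≫ S.g)
      invFun := fun f => f.1 ≫ S.f + f.2 ≫ σ.s
      map_add' := fun f g => by simp
      map_smul' := fun r f => by simp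
      left_inv := fun f => by
        have := congrArg (fun t => f ≫ t) σ.id
        simpa using this
      right_inv := fun f => by ext <;> simp }
  unfold homDim
  rw [e.finrank_eq, Module.finrank_prod]

open scoped Classical in
lemma homDim_simple [IsAlgClosed k] (X Y : C) [Simple X] [Simple Y] :
    homDim k X Y = if Nonempty (X ≅ Y) then 1 else 0 :=
  finrank_hom_simple_simple k X Y

lemma nonempty_iso_of_homDim_eq_one [IsAlgClosed k] {X Y : C} [Simple X] [Simple Y]
    (h : homDim k X Y = 1) : Nonempty (X ≅ Y) :=
  (finrank_hom_simple_simple_eq_one_iff k X Y).mp h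

lemma homDim_simple_self [IsAlgClosed k] (X : C) [Simple X] : homDim k X X = 1 :=
  (finrank_hom_simple_simple_eq_one_iff k X X).mpr ⟨Iso.refl X⟩

section Semisimple

variable [IsAlgClosed k]

lemma homDim_comm_of_semisimple (hC : ∀ X : C, ∃ (n : ℕ) (S : Fin n → C),
    (∀ i, Simple (S i)) ∧ Nonempty (X ≅ ⨁ S)) (X Y : C) :
    homDim k X Y = homDim k Y X := by
  classical
  obtain ⟨n, S, hS, ⟨e⟩⟩ := hC X
  obtain ⟨m, T, hT, ⟨f⟩⟩ := hC Y
  rw [homDim_congr k e f, homDim_congr k f e, homDim_biproduct_left, homDim_biproduct_right]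
  refine Finset.sum_congr rfl fun i _ => ?_
  rw [homDim_biproduct_left, homDim_biproduct_right]
  refine Finset.sum_congr rfl fun j _ => ?_
  have := hS i
  have := hT j
  rw [homDim_simple, homDim_simple]
  exact if_congr ⟨fun ⟨e⟩ => ⟨e.symm⟩, fun ⟨e⟩ => ⟨e.symm⟩⟩ rfl rfl

/-- Each simple summand contributes at least `1` to `dim End X` through its own identity, so there
is exactly one summand. -/
lemma simple_of_homDim_self_eq_one (hC : ∀ X : C, ∃ (n : ℕ) (S : Fin n → C),
    (∀ i, Simple (S i)) ∧ Nonempty (X ≅ ⨁ S)) {X : C}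
    (h : homDim k X X = 1) : Simple X := by
  obtain ⟨n, S, hS, ⟨e⟩⟩ := hC X
  have h1 : homDim k X X = ∑ i, ∑ j, homDim k (S i) (S j) := by
    rw [homDim_congr k e e, homDim_biproduct_left]
    exact Finset.sum_congr rfl fun i _ => homDim_biproduct_right k _ _
  have h2 : n ≤ homDim k X X := by
    rw [h1]
    calc n = ∑ i : Fin n, 1 := by simp
      _ ≤ _ := Finset.sum_le_sum fun i _ => by
        have := hS i
        rw [← homDim_simple_self k (S i)]
        exact Finset.single_le_sum (f := fun j => homDim k (S i) (S j))
          (fun _ _ => Nat.zero_le _) (Finset.mem_univ i)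
  have h3 : n ≠ 0 := by
    rintro rfl
    simp [h] at h1
  obtain rfl : n = 1 := by omega
  have := hS 0
  have e' : X ≅ S 0 := e ≪≫
    { hom := biproduct.π S 0
      inv := biproduct.ι S 0
      hom_inv_id := by
        ext i
        obtain rfl := Subsingleton.elim i 0
        simp
      inv_hom_id := by simp }
  exact Simple.of_iso e'

end Semisimple

end FiniteDimensional

section Monoidal

variable [MonoidalCategory C] [MonoidalPreadditive C] [MonoidalLinear k C]

/-- This is the adjunction between tensoring with an object and with its dual; all later facts on
duals are deduced from it by counting dimensions. -/
lemma homDim_exactPairing (X Y Y' Z : C) [ExactPairing Y Y'] :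
    homDim k (Y' ⊗ X) Z = homDim k X (Y ⊗ Z) := by
  let e : (Y' ⊗ X ⟶ Z) ≃ₗ[k] (X ⟶ Y ⊗ Z) :=
    { tensorLeftHomEquiv X Y Y' Z with
      map_add' := fun f g => by simp [tensorLeftHomEquiv, MonoidalPreadditive.whiskerLeft_add]
      map_smul' := fun r f => by simp [tensorLeftHomEquiv] }
  exact e.finrank_eq

lemma homDim_rightDual [RigidCategory C] (Y Z : C) :
    homDim k Yᘁ Z = homDim k (𝟙_ C) (Y ⊗ Z) := by
  rw [← homDim_exactPairing k (𝟙_ C) Y Yᘁ Z]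
  exact homDim_congr_left k (ρ_ _).symm Z

end Monoidal

end HomDim

end SymFusion

/-! ### Commutative algebra: endomorphisms of reduced rings finite over `ℤ` -/

/-- A monic integer polynomial has only finitely many roots in a reduced Noetherian ring. -/
lemma finite_setOf_aeval_eq_zero {R : Type*} [CommRing R] [IsNoetherianRing R] [IsReduced R]
    {p : Polynomial ℤ} (hp : p.Monic) : {x : R | Polynomial.aeval x p = 0}.Finite := by
  have hfin : Finite (minimalPrimes R) := (minimalPrimes.finite_of_isNoetherianRing R).to_subtype
  let f : R → (P : minimalPrimes R) → R ⧸ P.1 := fun x P => Ideal.Quotient.mk P.1 x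
  have hf : Function.Injective f := by
    intro x y hxy
    -- The minimal primes meet in the nilradical, which is zero, so `R` embeds in a finite product
    -- of domains.
    have h : x - y ∈ sInf (minimalPrimes R) := by
      rw [Submodule.mem_sInf]
      intro P hP
      exact Ideal.Quotient.eq.mp (congrFun hxy ⟨P, hP⟩)
    rw [minimalPrimes, Ideal.sInf_minimalPrimes] at h
    exact sub_eq_zero.mp (by simpa using mem_nilradical.mp h)
  refine Set.Finite.of_finite_image (f := f) ?_ hf.injOn
  refine Set.Finite.subset (Set.Finite.pi' (t := fun P : minimalPrimes R =>
    {y : R ⧸ P.1 | Polynomial.aeval y p = 0}) ?_) ?_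
  · intro P
    classical
    have := P.2.1.1
    refine Set.Finite.subset (p.map (Int.castRingHom (R ⧸ P.1))).roots.toFinset.finite_toSet ?_
    intro y hy
    simp only [Finset.mem_coe, Multiset.mem_toFinset]
    rw [Polynomial.mem_roots (hp.map _).ne_zero, Polynomial.IsRoot, Polynomial.eval_map]
    exact hy
  · rintro _ ⟨x, hx, rfl⟩ P
    have h : Polynomial.aeval (Ideal.Quotient.mk P.1 x) p = Ideal.Quotient.mk P.1
        (Polynomial.aeval x p) :=
      Polynomial.aeval_algHom_apply (Ideal.Quotient.mk P.1).toIntAlgHom x p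
    exact h.trans ((congrArg _ hx).trans (map_zero _))

/-- A reduced commutative ring of finite type as an abelian group has finitely many
endomorphisms. -/
lemma finite_ringHom_self {R : Type*} [CommRing R] [Module.Finite ℤ R] [IsReduced R] :
    Finite (R →+* R) := by
  have : IsNoetherianRing R := IsNoetherianRing.of_finite ℤ R
  obtain ⟨s, hs⟩ := Module.Finite.fg_top (R := ℤ) (M := R)
  -- An endomorphism sends `x` to another root of its integral equation `p x`, and it is determined
  -- by its values on the finite generating set `s`.
  choose p hp hp0 using fun x : R => Algebra.IsIntegral.isIntegral (R := ℤ) x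
  have hfin : (Set.pi Set.univ fun x : s => {y : R | Polynomial.aeval y (p x) = 0}).Finite :=
    Set.Finite.pi fun x => finite_setOf_aeval_eq_zero (hp x)
  have := hfin.to_subtype
  refine Finite.of_injective (β := (Set.pi Set.univ fun x : s =>
    {y : R | Polynomial.aeval y (p x) = 0})) (fun f => ⟨fun x => f x, fun x _ => ?_⟩) ?_
  · have h : Polynomial.aeval (f x) (p x) = f (Polynomial.aeval x.1 (p x)) :=
      Polynomial.aeval_algHom_apply f.toIntAlgHom x.1 (p x)
    exact h.trans ((congrArg f (hp0 x)).trans (map_zero f))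
  · intro f g hfg
    have h : f.toAddMonoidHom.toIntLinearMap = g.toAddMonoidHom.toIntLinearMap :=
      LinearMap.ext_on hs fun x hx => congrFun (congrArg Subtype.val hfg) ⟨x, hx⟩
    ext x
    exact LinearMap.congr_fun h x

/-- Two powers of `f` coincide by the pigeonhole principle, and injectivity cancels the smaller one.
-/
lemma isOfFinOrder_of_injective {R : Type*} [CommRing R] [Module.Finite ℤ R] [IsReduced R]
    {f : R →+* R} (hf : Function.Injective f) : IsOfFinOrder f := by
  have := finite_ringHom_self (R := R)
  obtain ⟨m, n, hmn, h⟩ := Finite.exists_ne_map_eq_of_infinite fun n : ℕ => f ^ n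
  wlog hlt : m < n generalizing m n
  · exact this n m hmn.symm h.symm (by omega)
  refine isOfFinOrder_iff_pow_eq_one.mpr ⟨n - m, by omega, ?_⟩
  ext x
  have hx : (f ^ m) ((f ^ (n - m)) x) = (f ^ m) x := by
    change (f ^ m * f ^ (n - m)) x = _
    rw [← pow_add, Nat.add_sub_cancel' hlt.le]
    exact (RingHom.congr_fun h x).symm
  rw [RingHom.coe_pow f m] at hx
  exact hf.iterate m hx

/-- A commutative ring with a bijective lift of the Frobenius modulo `2` is reduced, if it has no
`2`-torsion and no nonzero infinitely `2`-divisible elements. -/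
lemma isReduced_of_frobenius_lift {R : Type*} [CommRing R] (f : R →+* R)
    (hf : Function.Bijective f) (hsq : ∀ a, ∃ b, f a = a ^ 2 + 2 * b)
    (h2 : ∀ a : R, 2 * a = 0 → a = 0) (hdiv : ∀ a : R, (∀ n : ℕ, ∃ b, a = 2 ^ n * b) → a = 0) :
    IsReduced R := by
  -- A square-zero element is twice a square-zero element: `f a` is divisible by `2`, and this
  -- divisibility pulls back along the bijection `f`.
  have key : ∀ a : R, a ^ 2 = 0 → ∃ c, c ^ 2 = 0 ∧ a = 2 * c := by
    intro a ha
    obtain ⟨b, hb⟩ := hsq a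
    obtain ⟨c, rfl⟩ := hf.2 b
    have hac : a = 2 * c := hf.1 (by rw [hb, ha, zero_add, map_mul, map_ofNat])
    refine ⟨c, h2 _ (h2 _ ?_), hac⟩
    rw [hac] at ha
    linear_combination ha
  refine isReduced_iff_pow_one_lt 2 one_lt_two |>.mpr fun a ha => hdiv a fun n => ?_
  suffices h : ∃ b, b ^ 2 = 0 ∧ a = 2 ^ n * b from h.imp fun _ => And.right
  induction n with
  | zero => exact ⟨a, ha, by simp⟩
  | succ n ih =>
    obtain ⟨b, hb, rfl⟩ := ih
    obtain ⟨c, hc, rfl⟩ := key b hb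
    exact ⟨c, hc, by ring⟩

namespace SymFusion

attribute [local instance] Abelian.hasFiniteBiproducts

/-! ### Simple classes and generators of the Grothendieck ring -/

section GrothendieckRing

variable {C : Type u} [Category.{v} C] [Abelian C]

variable (C) in
/-- The type of isomorphism classes of simple objects. -/
def SimpleClass : Type u := {s : Skeleton C // ∃ X : C, Simple X ∧ toSkeleton X = s}

/-- A representative of an isomorphism class of simple objects. -/
noncomputable def SimpleClass.rep (s : SimpleClass C) : C := (fromSkeleton C).obj s.1

instance SimpleClass.simple_rep (s : SimpleClass C) : Simple s.rep := by
  obtain ⟨_, X, hX, rfl⟩ := s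
  exact Simple.of_iso (fromSkeletonToSkeletonIso X)

/-- The class of a simple object. -/
def SimpleClass.mk (X : C) [hX : Simple X] : SimpleClass C := ⟨toSkeleton X, X, hX, rfl⟩

/-- The representative of the class of `X` is isomorphic to `X`. -/
noncomputable def SimpleClass.repMkIso (X : C) [Simple X] : (SimpleClass.mk X).rep ≅ X :=
  fromSkeletonToSkeletonIso X

lemma SimpleClass.mk_eq_iff (X : C) [Simple X] (s : SimpleClass C) :
    SimpleClass.mk X = s ↔ Nonempty (X ≅ s.rep) := by
  refine Iff.trans ?_ toSkeleton_eq_iff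
  exact Subtype.ext_iff

/-- The additive extension of `Y ↦ dim Hom(X, Y)` to the free abelian group on isomorphism
classes. -/
noncomputable def freeMultiplicity (k : Type w) [Field k] [Linear k C] (X : C) : FreeAbelianGroup (Skeleton C) →+ ℤ :=
  FreeAbelianGroup.lift fun s => (homDim k X ((fromSkeleton C).obj s) : ℤ)

lemma freeMultiplicity_of (k : Type w) [Field k] [Linear k C] (X Y : C) :
    freeMultiplicity k X (FreeAbelianGroup.of (toSkeleton Y)) = homDim k X Y := by
  unfold freeMultiplicity
  rw [FreeAbelianGroup.lift_apply_of, homDim_congr_right k X (fromSkeletonToSkeletonIso Y)]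

variable [MonoidalCategory C] [SymmetricCategory C]

lemma cls_biproduct {n : ℕ} (S : Fin n → C) : cls (⨁ S) = ∑ i, cls (S i) := by
  induction n with
  | zero =>
    rw [Fin.sum_univ_zero]
    apply cls_isZero
    rw [IsZero.iff_id_eq_zero]
    ext i
    exact i.elim0
  | succ n ih =>
    rw [Fin.sum_univ_succ, ← ih fun i => S i.succ]
    let T : ShortComplex C := ShortComplex.mk (biproduct.ι S 0)
      (biproduct.lift fun i => biproduct.π S i.succ : ⨁ S ⟶ ⨁ fun i : Fin n => S i.succ) (by
        ext i
        simp [biproduct.ι_π_ne S (Fin.succ_ne_zero i).symm])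
    let σ : T.Splitting :=
      { r := biproduct.π S 0
        s := biproduct.desc fun i => biproduct.ι S i.succ
        f_r := by simp [T]
        s_g := by
          ext i j
          by_cases h : i = j
          · subst h
            simp [T]
          · simp [T, biproduct.ι_π_ne _ (Ne.symm h),
              biproduct.ι_π_ne S (fun h' => h (Fin.succ_injective _ h').symm)]
        id := by
          have := biproduct.total (f := S)
          rw [Fin.sum_univ_succ] at this
          rw [← this]
          congr 1
          simp [T, biproduct.lift_desc] }
    exact cls_shortExact σ.shortExact

lemma exists_eq_cls_sub_cls (a : GrothendieckRing C) : ∃ X Y : C, a = cls X - cls Y := by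
  let _ := HasZeroObject.zero' C
  have h0 : cls (0 : C) = 0 := cls_isZero (isZero_zero C)
  obtain ⟨a, rfl⟩ := Ideal.Quotient.mk_surjective a
  induction a using FreeAbelianGroup.induction_on with
  | zero => exact ⟨0, 0, by simp⟩
  | of s => exact ⟨(fromSkeleton C).obj s, 0, by
      rw [h0, sub_zero, cls, toSkeleton_fromSkeleton_obj]⟩
  | neg s _ => exact ⟨0, (fromSkeleton C).obj s, by
      rw [h0, zero_sub, cls, toSkeleton_fromSkeleton_obj, map_neg]⟩
  | add a b ha hb =>
    obtain ⟨X, Y, h⟩ := ha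
    obtain ⟨X', Y', h'⟩ := hb
    refine ⟨X ⊞ X', Y ⊞ Y', ?_⟩
    rw [map_add, h, h', cls_biprod, cls_biprod]
    ring

end GrothendieckRing

/-! ### Duality in a fusion category -/

section Fusion

variable (k : Type w) [Field k] [IsAlgClosed k] {C : Type u} [Category.{v} C] [Abelian C]
  [Linear k C] [MonoidalCategory C] [MonoidalPreadditive C] [MonoidalLinear k C]
  [SymmetricCategory C] [RigidCategory C] [IsFusionCategory k C]

include k

lemma homDim_comm (X Y : C) : homDim k X Y = homDim k Y X := by
  have := IsFusionCategory.finiteDimensional_hom (k := k) (C := C)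
  exact homDim_comm_of_semisimple k (IsFusionCategory.semisimple k) X Y

/-- Comparing dimensions suffices: the symmetry of `homDim` replaces any choice of an isomorphism
between an object and its double dual. -/
lemma homDim_rightDual_rightDual_left (Y Z : C) : homDim k (Yᘁ)ᘁ Z = homDim k Y Z := by
  rw [homDim_rightDual, homDim_comm, homDim_exactPairing k _ Y Yᘁ, homDim_comm,
    homDim_congr_left k (ρ_ Y)]

lemma homDim_rightDual_rightDual (Y Z : C) : homDim k Yᘁ Zᘁ = homDim k Y Z := by
  rw [homDim_rightDual, homDim_congr_right k _ (β_ Y Zᘁ), ← homDim_rightDual,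
    homDim_rightDual_rightDual_left, homDim_comm]

lemma simple_unit : Simple (𝟙_ C) := by
  have := IsFusionCategory.finiteDimensional_hom (k := k) (C := C)
  obtain ⟨e⟩ := IsFusionCategory.end_unit (k := k) (C := C)
  refine simple_of_homDim_self_eq_one k (IsFusionCategory.semisimple k) ?_
  exact e.toLinearEquiv.finrank_eq.trans (Module.finrank_self k)

lemma simple_rightDual (X : C) [Simple X] : Simple Xᘁ := by
  have := IsFusionCategory.finiteDimensional_hom (k := k) (C := C)
  refine simple_of_homDim_self_eq_one k (IsFusionCategory.semisimple k) ?_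
  rw [homDim_rightDual_rightDual, homDim_simple_self]

lemma nonempty_iso_rightDual_rightDual (X : C) [Simple X] : Nonempty ((Xᘁ)ᘁ ≅ X) := by
  have := IsFusionCategory.finiteDimensional_hom (k := k) (C := C)
  have := simple_rightDual k X
  have := simple_rightDual k Xᘁ
  apply nonempty_iso_of_homDim_eq_one k
  rw [homDim_rightDual_rightDual_left, homDim_simple_self]

lemma nonempty_iso_rightDual_of_iso_unit {X : C} (e : X ≅ 𝟙_ C) : Nonempty (X ≅ Xᘁ) := by
  have := IsFusionCategory.finiteDimensional_hom (k := k) (C := C)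
  have := simple_unit k (C := C)
  have := Simple.of_iso e
  have := simple_rightDual k X
  apply nonempty_iso_of_homDim_eq_one k
  rw [homDim_comm, homDim_rightDual,
    homDim_congr k e.symm ((whiskerRightIso e X) ≪≫ λ_ X), homDim_simple_self]

/-! ### Multiplicities on the Grothendieck ring -/

lemma freeMultiplicity_mul (X Z : C) (a : FreeAbelianGroup (Skeleton C)) :
    freeMultiplicity k X (FreeAbelianGroup.of (toSkeleton Z) * a) =
      freeMultiplicity k (Zᘁ ⊗ X) a := by
  induction a using FreeAbelianGroup.induction_on with
  | zero => simp
  | of s =>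
    obtain ⟨Y, rfl⟩ : ∃ Y, toSkeleton Y = s := ⟨_, toSkeleton_fromSkeleton_obj s⟩
    rw [FreeAbelianGroup.of_mul_of, ← Skeleton.toSkeleton_tensorObj, freeMultiplicity_of,
      freeMultiplicity_of, homDim_exactPairing k X Z Zᘁ]
  | neg s h => rw [mul_neg, map_neg, map_neg, h]
  | add a b ha hb => rw [mul_add, map_add, map_add, ha, hb]

lemma freeMultiplicity_eq_zero {a : FreeAbelianGroup (Skeleton C)}
    (ha : a ∈ grothendieckRelations C) (X : C) : freeMultiplicity k X a = 0 := by
  have := IsFusionCategory.finiteDimensional_hom (k := k) (C := C)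
  -- The relations span an ideal, so multiples must vanish too; multiplying by `[Y]` only replaces
  -- `X` by `Yᘁ ⊗ X`, which is why `X` is generalized.
  induction ha using Submodule.span_induction generalizing X with
  | mem a h =>
    obtain ⟨S, hS, rfl⟩ := h
    obtain ⟨σ⟩ := nonempty_splitting (IsFusionCategory.semisimple k) hS
    rw [map_sub, map_add, freeMultiplicity_of, freeMultiplicity_of, freeMultiplicity_of,
      homDim_splitting k X σ]
    push_cast
    ring
  | zero => simp
  | add a b _ _ ha hb => rw [map_add, ha, hb, add_zero]
  | smul r a _ ha =>
    rw [smul_eq_mul]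
    induction r using FreeAbelianGroup.induction_on with
    | zero => simp
    | of s =>
      obtain ⟨Y, rfl⟩ : ∃ Y, toSkeleton Y = s := ⟨_, toSkeleton_fromSkeleton_obj s⟩
      rw [freeMultiplicity_mul, ha]
    | neg s h => rw [neg_mul, map_neg, h, neg_zero]
    | add r s hr hs => rw [add_mul, map_add, hr, hs, add_zero]

/-- The additive map on the Grothendieck ring with `[Y] ↦ dim Hom(X, Y)`. -/
noncomputable def multiplicity (X : C) : GrothendieckRing C →+ ℤ :=
  QuotientAddGroup.lift (grothendieckRelations C).toAddSubgroup (freeMultiplicity k X)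
    fun _ ha => freeMultiplicity_eq_zero k ha X

lemma multiplicity_cls (X Y : C) : multiplicity k X (cls Y) = homDim k X Y :=
  freeMultiplicity_of k X Y

lemma finite_simpleClass : Finite (SimpleClass C) :=
  (IsFusionCategory.finite_simples k (C := C)).to_subtype

variable [Fintype (SimpleClass C)]

lemma eq_sum_multiplicity (a : GrothendieckRing C) :
    a = ∑ s : SimpleClass C, multiplicity k s.rep a • cls s.rep := by
  classical
  have := IsFusionCategory.finiteDimensional_hom (k := k) (C := C)
  have key (Y : C) : cls Y = ∑ s : SimpleClass C, multiplicity k s.rep (cls Y) • cls s.rep := by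
    obtain ⟨n, S, hS, ⟨e⟩⟩ := IsFusionCategory.semisimple k Y
    rw [cls_congr e, cls_biproduct]
    simp only [map_sum, Finset.sum_smul]
    rw [Finset.sum_comm]
    refine Finset.sum_congr rfl fun i _ => ?_
    have := hS i
    have h (s : SimpleClass C) : multiplicity k s.rep (cls (S i)) • cls s.rep =
        if SimpleClass.mk (S i) = s then cls (S i) else 0 := by
      rw [multiplicity_cls, homDim_comm, homDim_simple]
      simp only [← SimpleClass.mk_eq_iff]
      split_ifs with h
      · rw [cls_congr ((SimpleClass.mk_eq_iff _ _).mp h).some]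
        simp
      · simp
    simp only [h, Finset.sum_ite_eq, Finset.mem_univ, if_true]
  obtain ⟨X, Y, rfl⟩ := exists_eq_cls_sub_cls a
  simp only [map_sub, sub_smul, Finset.sum_sub_distrib]
  rw [← key, ← key]

lemma eq_zero_of_multiplicity_eq_zero {a : GrothendieckRing C}
    (h : ∀ X : C, multiplicity k X a = 0) : a = 0 := by
  rw [eq_sum_multiplicity k a]
  exact Finset.sum_eq_zero fun s _ => by rw [h, zero_smul]

lemma cls_eq_of_homDim_eq {X Y : C} (h : ∀ T : C, homDim k T X = homDim k T Y) :
    cls X = cls Y := by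
  refine sub_eq_zero.mp (eq_zero_of_multiplicity_eq_zero k fun T => ?_)
  rw [map_sub, multiplicity_cls, multiplicity_cls, h, sub_self]

/-- Both sides have the same Hom-dimensions by adjunction; the order reversal of duals disappears
because `K(C)` is commutative. -/
lemma cls_rightDual_tensor (X Y : C) : cls (X ⊗ Y)ᘁ = cls Xᘁ * cls Yᘁ := by
  rw [mul_comm, ← cls_tensor]
  refine cls_eq_of_homDim_eq k fun T => ?_
  rw [homDim_comm, homDim_rightDual, homDim_congr_right k _ (α_ X Y T), ← homDim_rightDual,
    ← homDim_exactPairing k _ Y Yᘁ, homDim_comm]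

lemma finite_grothendieckRing : Module.Finite ℤ (GrothendieckRing C) := by
  classical
  refine ⟨⟨Finset.univ.image fun s : SimpleClass C => cls s.rep, eq_top_iff.mpr fun a _ => ?_⟩⟩
  rw [eq_sum_multiplicity k a]
  exact Submodule.sum_mem _ fun s _ => Submodule.smul_mem _ _ (Submodule.subset_span (by simp))

lemma eq_zero_of_two_mul_eq_zero {a : GrothendieckRing C} (h : 2 * a = 0) : a = 0 := by
  refine eq_zero_of_multiplicity_eq_zero k fun X => ?_
  have := congrArg (multiplicity k X) h
  rw [two_mul, map_add, map_zero] at this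
  omega

lemma eq_zero_of_forall_two_pow_dvd {a : GrothendieckRing C}
    (h : ∀ n : ℕ, ∃ b, a = 2 ^ n * b) : a = 0 := by
  refine eq_zero_of_multiplicity_eq_zero k fun X => ?_
  by_contra hne
  -- The exponent is the absolute value `m` of the multiplicity itself: `2 ^ m` cannot divide a
  -- nonzero integer of absolute value `m`, as `m < 2 ^ m`.
  obtain ⟨b, hb⟩ := h (multiplicity k X a).natAbs
  have hm : multiplicity k X a = 2 ^ (multiplicity k X a).natAbs * multiplicity k X b := by
    conv_lhs => rw [hb, show (2 : GrothendieckRing C) ^ (multiplicity k X a).natAbs * b =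
      (2 ^ (multiplicity k X a).natAbs : ℤ) • b by rw [zsmul_eq_mul]; push_cast; rfl]
    rw [map_zsmul, smul_eq_mul]
  have hd := congrArg Int.natAbs hm
  rw [Int.natAbs_mul, Int.natAbs_pow] at hd
  exact Nat.lt_two_pow_self.not_ge (Nat.le_of_dvd (Int.natAbs_pos.mpr hne) ⟨_, hd⟩)

end Fusion

end SymFusion

namespace SymFusion

/-! ### Reduction modulo `2` and the classes `[Y] + [Y*]` -/

section EvenOrder

variable {C : Type u} [Category.{v} C] [Abelian C] [MonoidalCategory C] [SymmetricCategory C]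
  [RigidCategory C]

/-- A simple class is self-dual if its representative is isomorphic to its dual. -/
def SimpleClass.IsSelfDual (s : SimpleClass C) : Prop := Nonempty (s.rep ≅ s.repᘁ)

variable (C) in
/-- The subgroup of the Grothendieck ring generated by `2 K(C)` and the classes `[Y] + [Y*]`. -/
noncomputable def dualNorms : AddSubgroup (GrothendieckRing C) :=
  AddSubgroup.closure
    (Set.range (fun a : GrothendieckRing C => 2 * a) ∪ Set.range fun Y : C => cls Y + cls Yᘁ)

lemma two_mul_mem_dualNorms (a : GrothendieckRing C) : 2 * a ∈ dualNorms C :=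
  AddSubgroup.subset_closure (Or.inl ⟨a, rfl⟩)

lemma cls_add_cls_rightDual_mem_dualNorms (Y : C) : cls Y + cls Yᘁ ∈ dualNorms C :=
  AddSubgroup.subset_closure (Or.inr ⟨Y, rfl⟩)

variable (k : Type w) [Field k] [IsAlgClosed k] [Linear k C] [MonoidalPreadditive C]
  [MonoidalLinear k C] [IsFusionCategory k C]

/-- A self-dual `T` occurs equally often in `Y` and in `Y*`. This parity is what separates classes
modulo `dualNorms`. -/
lemma even_multiplicity_of_mem_dualNorms {T : C} (e : T ≅ Tᘁ) {a : GrothendieckRing C}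
    (ha : a ∈ dualNorms C) : Even (multiplicity k T a) := by
  induction ha using AddSubgroup.closure_induction with
  | mem a h =>
    obtain ⟨b, rfl⟩ | ⟨Y, rfl⟩ := h
    · simp [two_mul]
    · simp only
      rw [map_add, multiplicity_cls, multiplicity_cls, homDim_congr_left k e Yᘁ,
        homDim_rightDual_rightDual]
      exact ⟨_, rfl⟩
  | zero => simp
  | add a b _ _ ha hb => rw [map_add]; exact ha.add hb
  | neg a _ ha => rw [map_neg]; exact ha.neg

include k

lemma one_notMem_dualNorms : (1 : GrothendieckRing C) ∉ dualNorms C := by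
  have := IsFusionCategory.finiteDimensional_hom (k := k) (C := C)
  have := simple_unit k (C := C)
  intro h
  obtain ⟨e⟩ := nonempty_iso_rightDual_of_iso_unit k (Iso.refl (𝟙_ C))
  have := even_multiplicity_of_mem_dualNorms k e h
  rw [← cls_unit, multiplicity_cls, homDim_simple_self] at this
  simp at this

lemma cls_sub_one_notMem_dualNorms {X : C} [Simple X] (hX : IsEmpty (X ≅ 𝟙_ C)) :
    cls X - 1 ∉ dualNorms C := by
  have := IsFusionCategory.finiteDimensional_hom (k := k) (C := C)
  have := simple_unit k (C := C)
  intro h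
  obtain ⟨e⟩ := nonempty_iso_rightDual_of_iso_unit k (Iso.refl (𝟙_ C))
  have := even_multiplicity_of_mem_dualNorms k e h
  rw [← cls_unit, map_sub, multiplicity_cls, multiplicity_cls, homDim_simple_self, homDim_comm,
    homDim_simple, if_neg (not_nonempty_iff.mpr hX)] at this
  simp at this

variable [Fintype (SimpleClass C)]

/-- The subgroup need not be an ideal, but `([Y] + [Y*])² = 2[Y][Y*] + [Y ⊗ Y] + [(Y ⊗ Y)*]`, and
cross terms of sums are even. -/
lemma sq_mem_dualNorms {a : GrothendieckRing C} (ha : a ∈ dualNorms C) :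
    a ^ 2 ∈ dualNorms C := by
  induction ha using AddSubgroup.closure_induction with
  | mem a h =>
    obtain ⟨b, rfl⟩ | ⟨Y, rfl⟩ := h
    · simp only [show (2 * b) ^ 2 = 2 * (2 * b ^ 2) by ring]
      exact two_mul_mem_dualNorms _
    · have h := add_mem (two_mul_mem_dualNorms (cls Y * cls Yᘁ))
        (cls_add_cls_rightDual_mem_dualNorms (Y ⊗ Y))
      rw [cls_rightDual_tensor k, cls_tensor] at h
      convert h using 1
      ring
  | zero => simp
  | add a b _ _ ha hb =>
    rw [show (a + b) ^ 2 = a ^ 2 + b ^ 2 + 2 * (a * b) by ring]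
    exact add_mem (add_mem ha hb) (two_mul_mem_dualNorms _)
  | neg a _ ha => rwa [neg_sq]

open scoped Classical in
/-- Modulo `dualNorms`, a class with the same multiplicities at each simple object and at its dual
is supported on the self-dual simple objects. -/
lemma sub_sum_selfDual_mem_dualNorms {a : GrothendieckRing C}
    (ha : ∀ T : C, multiplicity k Tᘁ a = multiplicity k T a) :
    a - ∑ s : SimpleClass C with s.IsSelfDual, multiplicity k s.rep a • cls s.rep ∈
      dualNorms C := by
  have hdual (s : SimpleClass C) : Simple s.repᘁ := simple_rightDual k s.rep
  let d : SimpleClass C → SimpleClass C := fun s => SimpleClass.mk s.repᘁ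
  let e (s : SimpleClass C) : (d s).rep ≅ s.repᘁ := SimpleClass.repMkIso s.repᘁ
  have dd (s : SimpleClass C) : d (d s) = s := by
    obtain ⟨f⟩ := nonempty_iso_rightDual_rightDual k s.rep
    have := IsFusionCategory.finiteDimensional_hom (k := k) (C := C)
    have := hdual (d s)
    refine (SimpleClass.mk_eq_iff _ _).mpr (nonempty_iso_of_homDim_eq_one k ?_)
    rw [homDim_congr_right k _ f.symm, homDim_rightDual_rightDual, homDim_congr_left k (e s)]
    exact homDim_simple_self k _
  have hmem : ∑ s : SimpleClass C with ¬ s.IsSelfDual,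
      multiplicity k s.rep a • cls s.rep ∈ dualNorms C := by
    rw [← QuotientAddGroup.eq_zero_iff, ← QuotientAddGroup.mk'_apply, map_sum]
    -- Duality pairs off the remaining simple classes. Each pair has equal coefficients, so it
    -- contributes a multiple of `[Y] + [Y*]`; a fixed point would be self-dual.
    refine Finset.sum_involution (fun s _ => d s) ?_ ?_ ?_ ?_
    · intro s _
      rw [← map_add, QuotientAddGroup.mk'_apply, QuotientAddGroup.eq_zero_iff, cls_congr (e s)]
      have h : multiplicity k (d s).rep a = multiplicity k s.rep a := by
        rw [← ha s.rep, eq_sum_multiplicity k a]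
        simp only [map_sum, map_zsmul, multiplicity_cls, homDim_congr_left k (e s)]
      rw [h, ← smul_add]
      exact AddSubgroup.zsmul_mem _ (cls_add_cls_rightDual_mem_dualNorms _) _
    · intro s hs _ h
      exact (Finset.mem_filter.mp hs).2 (((SimpleClass.mk_eq_iff _ _).mp h).map Iso.symm)
    · intro s hs
      refine Finset.mem_filter.mpr ⟨Finset.mem_univ _, fun ⟨f⟩ => (Finset.mem_filter.mp hs).2 ?_⟩
      have := IsFusionCategory.finiteDimensional_hom (k := k) (C := C)
      apply nonempty_iso_of_homDim_eq_one k
      rw [homDim_congr_right k _ (e s).symm, ← homDim_rightDual_rightDual,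
        homDim_congr k (e s).symm f.symm, homDim_simple_self]
    · exact fun s _ => dd s
  have h := eq_sum_multiplicity k a
  rw [← Finset.sum_filter_add_sum_filter_not _ SimpleClass.IsSelfDual] at h
  rwa [sub_eq_of_eq_add' h]

/-- If `X` represents the only self-dual simple class besides `𝟙_ C`, then modulo `dualNorms` the
class `[X]²` is `1 + m [X]`, where `m` is the multiplicity of `X` in `X ⊗ X`. -/
lemma cls_sq_sub_mem_dualNorms {X : C} [Simple X] (e : X ≅ Xᘁ) (hX : IsEmpty (X ≅ 𝟙_ C))
    (h : selfDualSimples C = {toSkeleton (𝟙_ C), toSkeleton X}) :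
    cls X ^ 2 - (1 + (homDim k X (X ⊗ X) : ℤ) • cls X) ∈ dualNorms C := by
  classical
  have := IsFusionCategory.finiteDimensional_hom (k := k) (C := C)
  have := simple_unit k (C := C)
  have h1 : homDim k (𝟙_ C) (X ⊗ X) = 1 := by
    rw [← homDim_rightDual, homDim_congr_left k e.symm, homDim_simple_self]
  have hsymm (T : C) : multiplicity k Tᘁ (cls (X ⊗ X)) = multiplicity k T (cls (X ⊗ X)) := by
    have hX2 : cls (X ⊗ X) = cls (X ⊗ X)ᘁ := by
      rw [cls_rightDual_tensor k, ← cls_congr e, cls_tensor]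
    conv_lhs => rw [hX2]
    rw [multiplicity_cls, multiplicity_cls, homDim_rightDual_rightDual]
  have hfilter : (Finset.univ.filter fun s : SimpleClass C => s.IsSelfDual) =
      {SimpleClass.mk (𝟙_ C), SimpleClass.mk X} := by
    ext s
    have hs : s.1 ∈ selfDualSimples C ↔ s.IsSelfDual := by
      constructor
      · rintro ⟨Y, hY, ⟨f⟩, hYs⟩
        obtain rfl : SimpleClass.mk Y = s := Subtype.ext hYs
        have g := SimpleClass.repMkIso Y
        have := simple_rightDual k (SimpleClass.mk Y).rep
        apply nonempty_iso_of_homDim_eq_one k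
        -- Self-duality is rewritten as `dim Hom(𝟙, Y ⊗ Y) = 1`, a condition that visibly passes
        -- from `Y` to the chosen representative.
        rw [homDim_comm, homDim_rightDual,
          homDim_congr_right k _ (g ⊗ᵢ g), ← homDim_rightDual, homDim_congr_left k f.symm,
          homDim_simple_self]
      · exact fun f => ⟨s.rep, inferInstance, f, toSkeleton_fromSkeleton_obj s.1⟩
    simp only [Finset.mem_filter, Finset.mem_univ, true_and, ← hs, h, Finset.mem_insert,
      Finset.mem_singleton, Set.mem_insert_iff, Set.mem_singleton_iff]
    exact or_congr (Subtype.ext_iff (a1 := s) (a2 := SimpleClass.mk (𝟙_ C))).symm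
      (Subtype.ext_iff (a1 := s) (a2 := SimpleClass.mk X)).symm
  have hne : SimpleClass.mk (𝟙_ C) ≠ SimpleClass.mk X := fun hne =>
    hX.false (toSkeleton_eq_toSkeleton_iff.mp (Subtype.ext_iff.mp hne)).some.symm
  have key := sub_sum_selfDual_mem_dualNorms k hsymm
  rw [hfilter, Finset.sum_pair hne] at key
  have hm (Y : C) [Simple Y] : multiplicity k (SimpleClass.mk Y).rep (cls (X ⊗ X)) =
      homDim k Y (X ⊗ X) := by
    rw [multiplicity_cls, homDim_congr_left k (SimpleClass.repMkIso Y)]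
  rw [hm, hm, h1, cls_congr (SimpleClass.repMkIso X), cls_congr (SimpleClass.repMkIso (𝟙_ C)),
    cls_unit, Nat.cast_one, one_smul] at key
  rwa [sq, ← cls_tensor]

end EvenOrder

/-! ### The order of the second Adams operation -/

section AdamsOrder

variable (k : Type w) [Field k] [IsAlgClosed k] [NeZero (2 : k)] {C : Type u} [Category.{v} C]
  [Abelian C] [Linear k C] [MonoidalCategory C] [MonoidalPreadditive C] [MonoidalLinear k C]
  [SymmetricCategory C] [RigidCategory C] [IsFusionCategory k C]

lemma exists_adamsTwo_eq (a : GrothendieckRing C) : ∃ b, adamsTwo k C a = a ^ 2 + 2 * b := by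
  have key (X : C) : adamsTwo k C (cls X) = cls X ^ 2 + 2 * (-cls (extSq X)) := by
    let h := SignSplitting.ofBraiding k X
    let T : ShortComplex C := ShortComplex.mk h.i h.r h.ir
    let σ : T.Splitting := { r := h.q, s := h.j, f_r := h.iq, s_g := h.jr, id := h.total }
    have hT : cls (X ⊗ X) = cls (symSq X) + cls (extSq X) := cls_shortExact σ.shortExact
    rw [adamsTwo_cls, sq, ← cls_tensor, hT]
    ring
  obtain ⟨X, Y, rfl⟩ := exists_eq_cls_sub_cls a
  -- The last two terms turn `[X]² - [Y]²` into `([X] - [Y])²` up to an even correction.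
  refine ⟨-cls (extSq X) + cls (extSq Y) + cls X * cls Y - cls Y ^ 2, ?_⟩
  rw [map_sub, key, key]
  ring

variable [Fintype (SimpleClass C)]

/-- Modulo `2`, `ψ₂ a - b²` is `a² - b²`, hence `(a - b)²`, and squaring preserves `dualNorms`. -/
lemma adamsTwo_sub_sq_mem_dualNorms {a b : GrothendieckRing C} (h : a - b ∈ dualNorms C) :
    adamsTwo k C a - b ^ 2 ∈ dualNorms C := by
  obtain ⟨c, hc⟩ := exists_adamsTwo_eq k a
  rw [show adamsTwo k C a - b ^ 2 = (a - b) ^ 2 + 2 * (c + b * (a - b)) by rw [hc]; ring]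
  exact add_mem (sq_mem_dualNorms k h) (two_mul_mem_dualNorms _)

lemma isOfFinOrder_adamsTwo (hψ : Function.Bijective (adamsTwo k C)) :
    IsOfFinOrder (adamsTwo k C) := by
  have := finite_grothendieckRing k (C := C)
  have := isReduced_of_frobenius_lift (adamsTwo k C) hψ (exists_adamsTwo_eq k)
    (fun _ => eq_zero_of_two_mul_eq_zero k) (fun _ => eq_zero_of_forall_two_pow_dvd k)
  exact isOfFinOrder_of_injective hψ.1

lemma even_of_adamsTwo_pow_eq_one (hC : (selfDualSimples C).ncard = 2) {n : ℕ} (hn : n ≠ 0)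
    (h : adamsTwo k C ^ n = 1) : Even n := by
  have hunit : toSkeleton (𝟙_ C) ∈ selfDualSimples C :=
    ⟨𝟙_ C, simple_unit k, nonempty_iso_rightDual_of_iso_unit k (Iso.refl _), rfl⟩
  obtain ⟨x, hx1, hx⟩ : ∃ x, toSkeleton (𝟙_ C) ≠ x ∧
      selfDualSimples C = {toSkeleton (𝟙_ C), x} := by
    obtain ⟨x, y, hxy, hs⟩ := Set.ncard_eq_two.mp hC
    obtain h1 | h1 : toSkeleton (𝟙_ C) = x ∨ toSkeleton (𝟙_ C) = y := by simpa [hs] using hunit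
    · exact ⟨y, h1 ▸ hxy, h1 ▸ hs⟩
    · exact ⟨x, h1 ▸ hxy.symm, by rw [hs, h1, Set.pair_comm]⟩
  obtain ⟨X, hX, ⟨e⟩, rfl⟩ : x ∈ selfDualSimples C := by simp [hx]
  have hXI : IsEmpty (X ≅ 𝟙_ C) := ⟨fun f => hx1 (congr_toSkeleton_of_iso f.symm)⟩
  have hsq := cls_sq_sub_mem_dualNorms k e hXI hx
  have hpow (j : ℕ) : (adamsTwo k C ^ (j + 1)) (cls X) =
      adamsTwo k C ((adamsTwo k C ^ j) (cls X)) := by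
    rw [pow_succ']
    rfl
  obtain ⟨r, hr | hr⟩ := Nat.even_or_odd' (homDim k X (X ⊗ X))
  -- Even multiplicity: `[X]² ≡ 1`, and `1` is its own square, so every positive power of `ψ₂` sends
  -- `[X]` to `1` modulo `dualNorms`.
  · have hpow1 (j : ℕ) : (adamsTwo k C ^ (j + 1)) (cls X) - 1 ∈ dualNorms C := by
      induction j with
      | zero =>
        have h1 := adamsTwo_sub_sq_mem_dualNorms k (a := cls X) (b := cls X) (by simp)
        have := add_mem (add_mem h1 hsq) (two_mul_mem_dualNorms ((r : GrothendieckRing C) * cls X))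
        rw [hr, zsmul_eq_mul] at this
        convert this using 1
        rw [zero_add, pow_one]
        push_cast
        ring
      | succ j ih =>
        rw [hpow]
        simpa using adamsTwo_sub_sq_mem_dualNorms k ih
    obtain ⟨j, rfl⟩ := Nat.exists_eq_succ_of_ne_zero hn
    have := hpow1 j
    rw [← Nat.succ_eq_add_one, h] at this
    exact absurd this (cls_sub_one_notMem_dualNorms k hXI)
  -- Odd multiplicity: `[X]² ≡ 1 + [X]` and `(1 + [X])² ≡ [X]`, so even powers of `ψ₂` fix `[X]`
  -- modulo `dualNorms`.
  · have hpow2 (j : ℕ) : (adamsTwo k C ^ (2 * j)) (cls X) - cls X ∈ dualNorms C := by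
      induction j with
      | zero => simp
      | succ j ih =>
        have h1 := adamsTwo_sub_sq_mem_dualNorms k ih
        have h2 := add_mem (add_mem h1 hsq) (two_mul_mem_dualNorms ((r : GrothendieckRing C) * cls X))
        rw [hr, zsmul_eq_mul] at h2
        have h3 : adamsTwo k C ((adamsTwo k C ^ (2 * j)) (cls X)) - (1 + cls X) ∈
            dualNorms C := by
          convert h2 using 1
          push_cast
          ring
        have h4 := add_mem (add_mem (adamsTwo_sub_sq_mem_dualNorms k h3) hsq)
          (two_mul_mem_dualNorms (1 + cls X + (r : GrothendieckRing C) * cls X))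
        rw [hr, zsmul_eq_mul] at h4
        rw [show 2 * (j + 1) = 2 * j + 1 + 1 by ring, hpow, hpow]
        convert h4 using 1
        push_cast
        ring
    by_contra hodd
    obtain ⟨j, rfl⟩ := Nat.not_even_iff_odd.mp hodd
    -- If an odd power were the identity, then `[X] ≡ [X]² ≡ 1 + [X]`, which would put `1` in
    -- `dualNorms`.
    have h1 := adamsTwo_sub_sq_mem_dualNorms k (hpow2 j)
    rw [← hpow, h] at h1
    have h2 := neg_mem (add_mem (add_mem h1 hsq) (two_mul_mem_dualNorms ((r : GrothendieckRing C) * cls X)))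
    rw [hr, zsmul_eq_mul] at h2
    refine one_notMem_dualNorms k (C := C) ?_
    convert h2 using 1
    rw [show (1 : GrothendieckRing C →+* GrothendieckRing C) (cls X) = cls X from rfl]
    push_cast
    ring

end AdamsOrder


end SymFusion

theorem mainTheorem11 {k : Type w} [Field k] [IsAlgClosed k] [NeZero (2 : k)]
    {C : Type u} [Category.{v} C] [Abelian C] [Linear k C] [MonoidalCategory C]
    [MonoidalPreadditive C] [MonoidalLinear k C] [SymmetricCategory C] [RigidCategory C]
    [SymFusion.IsFusionCategory k C]
    (hC : (SymFusion.selfDualSimples C).ncard = 2)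
    (hψ : Function.Bijective (SymFusion.adamsTwo k C)) :
    0 < orderOf (SymFusion.adamsTwo k C) ∧ Even (orderOf (SymFusion.adamsTwo k C)) := by
  have := SymFusion.finite_simpleClass k (C := C)
  have := Fintype.ofFinite (SymFusion.SimpleClass C)
  have h := (SymFusion.isOfFinOrder_adamsTwo k hψ).orderOf_pos
  exact ⟨h, SymFusion.even_of_adamsTwo_pow_eq_one k hC h.ne' (pow_orderOf_eq_one _)⟩
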